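/- **Setting.** An ad query is a triple $(v,x,q)$: a value $v\in[0,1]$, a non-decreasing allocation function $x:[0,\infty)\to[0,1]$ with $x(0)=0$, and a non-decreasing payment function $q:[0,\infty)\to[0,1]$ with $q(b)\le b$ and $q(b)=0$ whenever $x(b)=0$; put $p(b)=q(b)x(b)$. For a horizon $T\ge 1$, queries $(v_t,x_t,q_t)$, $t=1,\dots,T$, are drawn i.i.d. from a distribution $\mathcal D$. An online algorithm $\mathcal A$ (possibly randomized, possibly depending on $T$, not knowing $\mathcal D$) chooses its bid $b_t\ge 0$ from $(v_\tau,x_\tau(b_\tau),p_\tau(b_\tau))_{\tau<t}$, the value $v_t$ and its own independent randomness. Let $$V_{\mathcal A}(\mathcal D,T)=\mathbb E\sum_{t=1}^T v_tx_t(b_t),\qquad \mathrm{CCV}_{\mathcal A}(T)=\sum_{t=1}^T\bigl(p_t(b_t)-v_tx_t(b_t)\bigr).$$ The return-on-spend constraint (ROSC) is $\mathbb E\sum_t p_t(b_t)\le \mathbb E\sum_t v_tx_t(b_t)$. Let $V_{\mathsf{OPT}}(\mathcal D,T)$ be the supremum of $V_{\mathcal B}(\mathcal D,T)$ over all such bidding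 algorithms $\mathcal B$, which may be chosen knowing $\mathcal D$, that satisfy the ROSC under $\mathcal D$. For a class $\mathfrak D$ of distributions let $$\mathcal R_{\mathcal A}(T;\mathfrak D)=\sup_{\mathcal D\in\mathfrak D}\bigl(V_{\mathsf{OPT}}(\mathcal D,T)-V_{\mathcal A}(\mathcal D,T)\bigr),\qquad \mathcal C_{\mathcal A}(T;\mathfrak D)=\sup_{\mathcal D\in\mathfrak D}\mathbb E_{\mathcal D}[\mathrm{CCV}_{\mathcal A}(T)].$$ **Theorem.** Let $0<v<1$, and let $\mathfrak D_v$ be the class of all distributions with $v_t=v$ for all $t$ (repeated identical auction). There is a constant $c>0$, depending only on $v$, such that for every $T\ge1$ and every online algorithm $\mathcal A$ $$\mathcal R_{\mathcal A}(T;\mathfrak D_v)+\mathcal C_{\mathcal A}(T;\mathfrak D_v)\ \ge\ c\sqrt T .$$ The same holds with $\mathfrak D_v$ replaced by its subclass of threshold inputs, where $x_t(b)=\mathbf 1\{b\ge\theta_t\}$ and $p_t(b)=\theta_t\mathbf 1\{b\ge\theta_t\}$ with random $\theta_t\in(0,1]$. -/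

import Mathlib

open MeasureTheory
open scoped NNReal

noncomputable section

namespace AutoBid

/-- The law of one ad query `(v, x, q)`, presented as a random element on a probability space:
a value `v ∈ [0,1]`, a non-decreasing allocation function `x : [0,∞) → [0,1]` with `x 0 = 0`, and a
non-decreasing per-win payment function `q : [0,∞) → [0,1]` that vanishes where `x` does and is at
most the bid. -/
structure InputLaw where
  Ω : Type
  [mΩ : MeasurableSpace Ω]
  law : Measure Ω
  [isProb : IsProbabilityMeasure law]
  value : Ω → ℝ
  alloc : Ω → ℝ≥0 → ℝ
  price : Ω → ℝ≥0 → ℝ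
  measurable_value : Measurable value
  measurable_alloc : Measurable (fun z : Ω × ℝ≥0 => alloc z.1 z.2)
  measurable_price : Measurable (fun z : Ω × ℝ≥0 => price z.1 z.2)
  value_mem : ∀ ω, value ω ∈ Set.Icc (0 : ℝ) 1
  alloc_mem : ∀ ω b, alloc ω b ∈ Set.Icc (0 : ℝ) 1
  alloc_mono : ∀ ω, Monotone (alloc ω)
  alloc_zero : ∀ ω, alloc ω 0 = 0
  price_mem : ∀ ω b, price ω b ∈ Set.Icc (0 : ℝ) 1
  price_mono : ∀ ω, Monotone (price ω)
  price_eq_zero : ∀ ω b, alloc ω b = 0 → price ω b = 0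
  price_le_bid : ∀ ω b, price ω b ≤ b

attribute [instance] InputLaw.mΩ InputLaw.isProb

/-- The expected payment function `p = q x`. -/
def InputLaw.payment (D : InputLaw) (ω : D.Ω) (b : ℝ≥0) : ℝ :=
  D.price ω b * D.alloc ω b

/-- A (possibly randomized) online bidding algorithm. In slot `t` (slots are numbered from `0`)
the bid is a function of an internal random seed, of the triples `(v_τ, x_τ(b_τ), p_τ(b_τ))`
observed in the slots `τ < t`, and of the current value `v_t`. -/
structure OnlineAlg where
  Seed : Type
  [mSeed : MeasurableSpace Seed]
  seedLaw : Measure Seed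
  [isProb : IsProbabilityMeasure seedLaw]
  bid : (t : ℕ) → Seed → (Fin t → ℝ × ℝ × ℝ) → ℝ → ℝ≥0
  measurable_bid : ∀ t : ℕ, Measurable
    (fun z : Seed × (Fin t → ℝ × ℝ × ℝ) × ℝ => bid t z.1 z.2.1 z.2.2)

attribute [instance] OnlineAlg.mSeed OnlineAlg.isProb

/-- What algorithm `A` with seed `s` has observed before slot `t`, on the input sequence `ω`. -/
def history (A : OnlineAlg) (D : InputLaw) {T : ℕ} (ω : Fin T → D.Ω) (s : A.Seed) :
    (t : ℕ) → t ≤ T → (Fin t → ℝ × ℝ × ℝ)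
  | 0, _ => Fin.elim0
  | t + 1, h =>
      let past := history A D ω s t (Nat.le_of_succ_le h)
      let q : D.Ω := ω ⟨t, h⟩
      let b : ℝ≥0 := A.bid t s past (D.value q)
      Fin.snoc (α := fun _ => ℝ × ℝ × ℝ) past (D.value q, D.alloc q b, D.payment q b)

/-- The bid `b_t` of `A` with seed `s` in slot `t`, on the input sequence `ω`. -/
def bidAt (A : OnlineAlg) (D : InputLaw) {T : ℕ} (ω : Fin T → D.Ω) (s : A.Seed) (t : Fin T) :
    ℝ≥0 :=
  A.bid t s (history A D ω s t t.isLt.le) (D.value (ω t))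

/-- The joint law of `T` i.i.d. queries drawn from `D` and of the independent seed of `A`. -/
def runLaw (A : OnlineAlg) (D : InputLaw) (T : ℕ) : Measure ((Fin T → D.Ω) × A.Seed) :=
  (Measure.pi fun _ : Fin T => D.law).prod A.seedLaw

/-- The accrued valuation `∑ v_t x_t(b_t)` on a sample path. -/
def pathValue (A : OnlineAlg) (D : InputLaw) (T : ℕ) (z : (Fin T → D.Ω) × A.Seed) : ℝ :=
  ∑ t : Fin T, D.value (z.1 t) * D.alloc (z.1 t) (bidAt A D z.1 z.2 t)

/-- The total payment `∑ p_t(b_t)` on a sample path. -/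
def pathPayment (A : OnlineAlg) (D : InputLaw) (T : ℕ) (z : (Fin T → D.Ω) × A.Seed) : ℝ :=
  ∑ t : Fin T, D.payment (z.1 t) (bidAt A D z.1 z.2 t)

/-- `CCV(T) = ∑ (p_t(b_t) - v_t x_t(b_t))` on a sample path. -/
def pathCCV (A : OnlineAlg) (D : InputLaw) (T : ℕ) (z : (Fin T → D.Ω) × A.Seed) : ℝ :=
  ∑ t : Fin T, (D.payment (z.1 t) (bidAt A D z.1 z.2 t)
    - D.value (z.1 t) * D.alloc (z.1 t) (bidAt A D z.1 z.2 t))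

/-- `V_A(T)`, the expected accrued valuation of `A` under `D`. -/
def expValue (A : OnlineAlg) (D : InputLaw) (T : ℕ) : ℝ :=
  ∫ z, pathValue A D T z ∂(runLaw A D T)

/-- `E[CCV_A(T)]` under `D`. -/
def expCCV (A : OnlineAlg) (D : InputLaw) (T : ℕ) : ℝ :=
  ∫ z, pathCCV A D T z ∂(runLaw A D T)

/-- The return-on-spend constraint: the expected total payment is at most the expected accrued
valuation. -/
def SatisfiesROSC (A : OnlineAlg) (D : InputLaw) (T : ℕ) : Prop :=
  ∫ z, pathPayment A D T z ∂(runLaw A D T) ≤ ∫ z, pathValue A D T z ∂(runLaw A D T)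

/-- `V_OPT(T)`: the best expected accrued valuation under `D` of a bidding algorithm that may be
chosen knowing `D` (but does not see the realizations in advance) and satisfies the return-on-spend
constraint under `D`. All the values lie in `[0, T]`, and bidding `0` is feasible. -/
def optValue (D : InputLaw) (T : ℕ) : ℝ :=
  sSup {r : ℝ | ∃ B : OnlineAlg, SatisfiesROSC B D T ∧ r = expValue B D T}

/-- The regret of `A` at horizon `T`, worst case over the input laws in the class `𝒟`. (The
differences lie in `[-T, T]`.) -/
def regret (𝒟 : Set InputLaw) (A : OnlineAlg) (T : ℕ) : ℝ :=
  sSup {r : ℝ | ∃ D ∈ 𝒟, r = optValue D T - expValue A D T}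

/-- The expected cumulative constraint violation of `A` at horizon `T`, worst case over the input
laws in the class `𝒟`. (The expectations lie in `[-T, T]`.) -/
def worstCCV (𝒟 : Set InputLaw) (A : OnlineAlg) (T : ℕ) : ℝ :=
  sSup {r : ℝ | ∃ D ∈ 𝒟, r = expCCV A D T}

/-- Repeated identical auctions: every query has the value `v`. -/
def repeatedLaws (v : ℝ) : Set InputLaw :=
  {D | ∀ ω, D.value ω = v}

/-- Repeated identical auctions of threshold type: `x(b) = 1` and `p(b) = θ` for `b ≥ θ`, and both
are `0` for `b < θ`, with a random threshold `θ ≤ 1`. -/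
def thresholdLaws (v : ℝ) : Set InputLaw :=
  {D | (∀ ω, D.value ω = v) ∧ ∀ ω, ∃ θ : ℝ≥0, θ ≤ 1 ∧ ∀ b : ℝ≥0,
    D.alloc ω b = (if θ ≤ b then 1 else 0) ∧ D.payment ω b = (if θ ≤ b then (θ : ℝ) else 0)}

end AutoBid

end

/-! Fix a small `d` and let the price be `v - d` or `v + d`, the latter with probability `p`. Each
bid below `v + d` loses value `v p` and saves `p d` of constraint violation, and the algorithm
learns nothing but the past prices. At `p = 1 / 2` always buying is feasible, so few low bids are
affordable. At `p = 1 / 2 + ε` always buying overspends by `2 ε d T`, so many low bids are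
necessary. At `p = 1 / 2 + 2 ε` randomizing over two static bids is feasible at the cost of
`O(ε T)` low bids, so not more than that many are affordable. For `ε = 1 / (16 √T)` the three
price sequences are hard to tell apart: Cauchy–Schwarz bounds the expected numbers `N₀`, `N₁`,
`N₂` of low bids by `N₁² ≤ 2 N₀ N₂`, which rules out `N₀ = o(√T)`, `N₂ = O(√T)` and `N₁ ≥ c √T`
together.
-/

noncomputable section

namespace AutoBid

open ProbabilityTheory

section Probability

theorem measurePreserving_update {ι : Type*} [Fintype ι] [DecidableEq ι] {X : ι → Type*}
    [∀ i, MeasurableSpace (X i)] (μ : ∀ i, Measure (X i)) [∀ i, IsProbabilityMeasure (μ i)]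
    (i : ι) :
    MeasurePreserving (fun z : (∀ j, X j) × X i => Function.update z.1 i z.2)
      ((Measure.pi μ).prod (μ i)) (Measure.pi μ) := by
  refine ⟨measurable_update', (Measure.pi_eq fun s hs => ?_).symm⟩
  have preimage_box : (fun z : (∀ j, X j) × X i => Function.update z.1 i z.2) ⁻¹' Set.univ.pi s
      = Set.univ.pi (Function.update s i Set.univ) ×ˢ s i := by
    ext ⟨y, x⟩
    simp only [Set.mem_preimage, Set.mem_univ_pi, Set.mem_prod]
    rw [Function.forall_update_iff y fun j z => z ∈ s j,
      Function.forall_update_iff s fun j u => y j ∈ u]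
    simp [and_comm]
  rw [Measure.map_apply measurable_update' (.univ_pi hs), preimage_box, Measure.prod_prod,
    Measure.pi_pi, ← Finset.prod_erase_mul _ _ (Finset.mem_univ i),
    ← Finset.prod_erase_mul Finset.univ (fun j => μ j (s j)) (Finset.mem_univ i),
    Function.update_self, measure_univ, mul_one]
  congr 1
  exact Finset.prod_congr rfl fun j hj => by rw [Function.update_of_ne (Finset.ne_of_mem_erase hj)]

theorem integrable_of_abs_le {α : Type*} [MeasurableSpace α] {μ : Measure α} [IsFiniteMeasure μ]
    {f : α → ℝ} {C : ℝ} (hf : Measurable f) (hC : ∀ x, |f x| ≤ C) : Integrable f μ :=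
  .of_bound hf.aestronglyMeasurable C (.of_forall hC)

theorem abs_integral_sum_le {α ι : Type*} [MeasurableSpace α] [Fintype ι] (μ : Measure α)
    [IsProbabilityMeasure μ] {f : ι → α → ℝ} (hf : ∀ i x, |f i x| ≤ 1) :
    |∫ x, ∑ i, f i x ∂μ| ≤ Fintype.card ι := by
  have abs_sum_le (x : α) : |∑ i, f i x| ≤ Fintype.card ι := by
    simpa using (Finset.abs_sum_le_sum_abs _ _).trans
      (Finset.sum_le_sum fun i (_ : i ∈ Finset.univ) => hf i x)
  simpa using norm_integral_le_of_norm_le_const (μ := μ) (f := fun x => ∑ i, f i x)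
    (.of_forall abs_sum_le)

theorem mul_sq_integral_le_of_singleton {Ω : Type*} [Finite Ω] [MeasurableSpace Ω]
    [MeasurableSingletonClass Ω] {μ₀ μ₁ μ₂ : Measure Ω} [IsFiniteMeasure μ₀] [IsFiniteMeasure μ₁]
    [IsFiniteMeasure μ₂] {r : ℝ} (hr : 0 ≤ r)
    (h : ∀ x, r * μ₁.real {x} ^ 2 ≤ μ₀.real {x} * μ₂.real {x}) {f : Ω → ℝ} (hf : ∀ x, 0 ≤ f x) :
    r * (∫ x, f x ∂μ₁) ^ 2 ≤ (∫ x, f x ∂μ₀) * ∫ x, f x ∂μ₂ := by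
  have := Fintype.ofFinite Ω
  simp only [integral_fintype Integrable.of_finite, smul_eq_mul]
  rw [← Real.sq_sqrt hr, ← mul_pow, Finset.mul_sum]
  refine Finset.sum_sq_le_sum_mul_sum_of_sq_le_mul _
    (fun x _ => mul_nonneg measureReal_nonneg (hf x))
    (fun x _ => mul_nonneg measureReal_nonneg (hf x)) fun x _ => ?_
  calc (√r * (μ₁.real {x} * f x)) ^ 2 = r * μ₁.real {x} ^ 2 * f x ^ 2 := by
        rw [mul_pow, Real.sq_sqrt hr, mul_pow, mul_assoc]
    _ ≤ μ₀.real {x} * μ₂.real {x} * f x ^ 2 :=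
        mul_le_mul_of_nonneg_right (h x) (sq_nonneg _)
    _ = μ₀.real {x} * f x * (μ₂.real {x} * f x) := by ring

theorem pow_mul_sq_pi_real_singleton_le {Ω : Type*} [MeasurableSpace Ω] {μ₀ μ₁ μ₂ : Measure Ω}
    [SigmaFinite μ₀] [SigmaFinite μ₁] [SigmaFinite μ₂] {r : ℝ} (hr : 0 ≤ r)
    (h : ∀ x, r * μ₁.real {x} ^ 2 ≤ μ₀.real {x} * μ₂.real {x}) {T : ℕ} (ω : Fin T → Ω) :
    r ^ T * (Measure.pi fun _ : Fin T => μ₁).real {ω} ^ 2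
      ≤ (Measure.pi fun _ : Fin T => μ₀).real {ω} * (Measure.pi fun _ : Fin T => μ₂).real {ω} := by
  simp only [measureReal_def, Measure.pi_singleton, ENNReal.toReal_prod] at h ⊢
  calc r ^ T * (∏ t, (μ₁ {ω t}).toReal) ^ 2 = ∏ t, r * (μ₁ {ω t}).toReal ^ 2 := by
        rw [Finset.prod_mul_distrib, Finset.prod_const, Finset.prod_pow, Finset.card_univ,
          Fintype.card_fin]
    _ ≤ ∏ t, (μ₀ {ω t}).toReal * (μ₂ {ω t}).toReal :=
        Finset.prod_le_prod (fun t _ => by positivity) fun t _ => h (ω t)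
    _ = (∏ t, (μ₀ {ω t}).toReal) * ∏ t, (μ₂ {ω t}).toReal := Finset.prod_mul_distrib

end Probability

section Bounds

variable (D : InputLaw)

theorem payment_mem_Icc (x : D.Ω) (b : ℝ≥0) : D.payment x b ∈ Set.Icc (0 : ℝ) 1 :=
  unitInterval.mul_mem (D.price_mem x b) (D.alloc_mem x b)

theorem gain_mem_Icc (x : D.Ω) (b : ℝ≥0) : D.value x * D.alloc x b ∈ Set.Icc (0 : ℝ) 1 :=
  unitInterval.mul_mem (D.value_mem x) (D.alloc_mem x b)

theorem abs_payment_le_one (x : D.Ω) (b : ℝ≥0) : |D.payment x b| ≤ 1 :=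
  abs_le.2 ⟨by linarith [(payment_mem_Icc D x b).1], (payment_mem_Icc D x b).2⟩

theorem abs_gain_le_one (x : D.Ω) (b : ℝ≥0) : |D.value x * D.alloc x b| ≤ 1 :=
  abs_le.2 ⟨by linarith [(gain_mem_Icc D x b).1], (gain_mem_Icc D x b).2⟩

theorem abs_payment_sub_gain_le_one (x : D.Ω) (b : ℝ≥0) :
    |D.payment x b - D.value x * D.alloc x b| ≤ 1 :=
  abs_sub_le_of_le_of_le (payment_mem_Icc D x b).1 (payment_mem_Icc D x b).2
    (gain_mem_Icc D x b).1 (gain_mem_Icc D x b).2 |>.trans_eq (sub_zero 1)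

instance (A : OnlineAlg) (T : ℕ) : IsProbabilityMeasure (runLaw A D T) := by
  unfold runLaw; infer_instance

theorem abs_expValue_le (A : OnlineAlg) (T : ℕ) : |expValue A D T| ≤ T :=
  (abs_integral_sum_le _ fun _ _ => abs_gain_le_one D _ _).trans_eq (by simp)

theorem abs_expCCV_le (A : OnlineAlg) (T : ℕ) : |expCCV A D T| ≤ T :=
  (abs_integral_sum_le _ fun _ _ => abs_payment_sub_gain_le_one D _ _).trans_eq (by simp)

theorem optValue_le (T : ℕ) : optValue D T ≤ T := by
  refine Real.sSup_le ?_ (Nat.cast_nonneg T)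
  rintro _ ⟨B, -, rfl⟩
  exact le_of_abs_le (abs_expValue_le D B T)

variable {D}

theorem expValue_le_optValue {B : OnlineAlg} {T : ℕ} (hB : SatisfiesROSC B D T) :
    expValue B D T ≤ optValue D T := by
  refine le_csSup ⟨T, ?_⟩ ⟨B, hB, rfl⟩
  rintro _ ⟨B, -, rfl⟩
  exact le_of_abs_le (abs_expValue_le D B T)

variable {𝒟 : Set InputLaw}

theorem optValue_sub_expValue_le_regret (hD : D ∈ 𝒟) (A : OnlineAlg) (T : ℕ) :
    optValue D T - expValue A D T ≤ regret 𝒟 A T := by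
  refine le_csSup ⟨T + T, ?_⟩ ⟨D, hD, rfl⟩
  rintro _ ⟨D, -, rfl⟩
  linarith [optValue_le D T, neg_le_of_abs_le (abs_expValue_le D A T)]

theorem expCCV_le_worstCCV (hD : D ∈ 𝒟) (A : OnlineAlg) (T : ℕ) :
    expCCV A D T ≤ worstCCV 𝒟 A T := by
  refine le_csSup ⟨T, ?_⟩ ⟨D, hD, rfl⟩
  rintro _ ⟨D, -, rfl⟩
  exact le_of_abs_le (abs_expCCV_le D A T)

end Bounds

section Bids

variable (A : OnlineAlg) (D : InputLaw) {T : ℕ}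

theorem history_congr {ω ω' : Fin T → D.Ω} (s : A.Seed) :
    ∀ (t : ℕ) (h : t ≤ T), (∀ i : Fin T, (i : ℕ) < t → ω i = ω' i) →
      history A D ω s t h = history A D ω' s t h
  | 0, _, _ => rfl
  | t + 1, h, hω => by
    simp only [history]
    rw [history_congr s t (Nat.le_of_succ_le h) fun i hi => hω i (Nat.lt_succ_of_lt hi),
      hω ⟨t, h⟩ (Nat.lt_succ_self t)]

theorem bidAt_update {ω : Fin T → D.Ω} {t : Fin T} {x : D.Ω} (hx : D.value x = D.value (ω t))
    (s : A.Seed) : bidAt A D (Function.update ω t x) s t = bidAt A D ω s t := by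
  simp only [bidAt, Function.update_self, hx]
  rw [history_congr A D s t t.isLt.le fun i hi => Function.update_of_ne (Fin.ne_of_lt hi) x ω]

theorem measurable_payment : Measurable fun z : D.Ω × ℝ≥0 => D.payment z.1 z.2 :=
  D.measurable_price.mul D.measurable_alloc

theorem measurable_gain : Measurable fun z : D.Ω × ℝ≥0 => D.value z.1 * D.alloc z.1 z.2 :=
  (D.measurable_value.comp measurable_fst).mul D.measurable_alloc

theorem measurable_history :
    ∀ (t : ℕ) (h : t ≤ T),
      Measurable fun z : (Fin T → D.Ω) × A.Seed => history A D z.1 z.2 t h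
  | 0, _ => measurable_const
  | t + 1, h => by
    have past := measurable_history t (Nat.le_of_succ_le h)
    have query : Measurable fun z : (Fin T → D.Ω) × A.Seed => z.1 ⟨t, h⟩ :=
      (measurable_pi_apply _).comp measurable_fst
    have val := D.measurable_value.comp query
    have bid := (A.measurable_bid t).comp (measurable_snd.prodMk (past.prodMk val))
    refine measurable_pi_iff.2 fun i => ?_
    simp only [history]
    refine Fin.lastCases ?_ (fun j => ?_) i
    · simp only [Fin.snoc_last]
      exact val.prodMk ((D.measurable_alloc.comp (query.prodMk bid)).prodMk
        ((measurable_payment D).comp (query.prodMk bid)))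
    · simp only [Fin.snoc_castSucc]
      exact (measurable_pi_apply j).comp past

theorem measurable_bidAt (t : Fin T) :
    Measurable fun z : (Fin T → D.Ω) × A.Seed => bidAt A D z.1 z.2 t :=
  (A.measurable_bid t).comp (measurable_snd.prodMk ((measurable_history A D t t.isLt.le).prodMk
    (D.measurable_value.comp ((measurable_pi_apply t).comp measurable_fst))))

end Bids

/-- `D` with the sampling measure of its queries replaced by `μ`: an algorithm reacts to the same
queries in the same way, whatever their distribution. -/
abbrev InputLaw.withLaw (D : InputLaw) (μ : Measure D.Ω) [IsProbabilityMeasure μ] : InputLaw :=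
  { D with law := μ, isProb := inferInstance }

theorem history_withLaw (A : OnlineAlg) (D : InputLaw) (μ : Measure D.Ω) [IsProbabilityMeasure μ]
    {T : ℕ} (ω : Fin T → D.Ω) (s : A.Seed) :
    ∀ (t : ℕ) (h : t ≤ T), history A (D.withLaw μ) ω s t h = history A D ω s t h
  | 0, _ => rfl
  | t + 1, h => by
    simp only [history]
    rw [history_withLaw A D μ ω s t (Nat.le_of_succ_le h)]
    rfl

theorem bidAt_withLaw (A : OnlineAlg) (D : InputLaw) (μ : Measure D.Ω) [IsProbabilityMeasure μ]
    {T : ℕ} (ω : Fin T → D.Ω) (s : A.Seed) (t : Fin T) :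
    bidAt A (D.withLaw μ) ω s t = bidAt A D ω s t := by
  simp only [bidAt]
  rw [history_withLaw]

section MeanRewards

/-- The expected gain `E[v x(b)]` in a single auction from the bid `b`. -/
def InputLaw.meanGain (D : InputLaw) (b : ℝ≥0) : ℝ :=
  ∫ x, D.value x * D.alloc x b ∂D.law

/-- The expected payment `E[p(b)]` in a single auction for the bid `b`. -/
def InputLaw.meanPayment (D : InputLaw) (b : ℝ≥0) : ℝ :=
  ∫ x, D.payment x b ∂D.law

variable {v : ℝ} {D : InputLaw} (A : OnlineAlg) {T : ℕ}

theorem measurePreserving_update_runLaw (t : Fin T) :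
    MeasurePreserving (fun y : ((Fin T → D.Ω) × A.Seed) × D.Ω =>
      (Function.update y.1.1 t y.2, y.1.2)) ((runLaw A D T).prod D.law) (runLaw A D T) :=
  ((measurePreserving_update (fun _ : Fin T => D.law) t).prod (.id A.seedLaw)).comp
    ((measurePreserving_prodAssoc _ _ _).symm.comp
      (((MeasurePreserving.id _).prod Measure.measurePreserving_swap).comp
        (measurePreserving_prodAssoc _ _ _)))

variable {g : D.Ω → ℝ≥0 → ℝ} {C : ℝ}

theorem integrable_reward (hg : Measurable fun z : D.Ω × ℝ≥0 => g z.1 z.2)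
    (hC : ∀ x b, |g x b| ≤ C) (t : Fin T) :
    Integrable (fun z : (Fin T → D.Ω) × A.Seed => g (z.1 t) (bidAt A D z.1 z.2 t))
      (runLaw A D T) :=
  integrable_of_abs_le (hg.comp (((measurable_pi_apply t).comp measurable_fst).prodMk
    (measurable_bidAt A D t))) fun _ => hC _ _

theorem integrable_resampled_reward (hg : Measurable fun z : D.Ω × ℝ≥0 => g z.1 z.2)
    (hC : ∀ x b, |g x b| ≤ C) (t : Fin T) :
    Integrable (fun y : ((Fin T → D.Ω) × A.Seed) × D.Ω => g y.2 (bidAt A D y.1.1 y.1.2 t))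
      ((runLaw A D T).prod D.law) :=
  integrable_of_abs_le (hg.comp (measurable_snd.prodMk
    ((measurable_bidAt A D t).comp measurable_fst))) fun _ => hC _ _

/-- The value being constant, the bid in slot `t` carries no information about the query of slot
`t`, which may therefore be resampled independently. -/
theorem integral_reward_eq (hD : D ∈ repeatedLaws v)
    (hg : Measurable fun z : D.Ω × ℝ≥0 => g z.1 z.2) (hC : ∀ x b, |g x b| ≤ C) (t : Fin T) :
    ∫ z, g (z.1 t) (bidAt A D z.1 z.2 t) ∂(runLaw A D T)
      = ∫ z, ∫ x, g x (bidAt A D z.1 z.2 t) ∂D.law ∂(runLaw A D T) := by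
  have resample := measurePreserving_update_runLaw (D := D) A t
  have reward_integrable := integrable_reward A hg hC t
  calc ∫ z, g (z.1 t) (bidAt A D z.1 z.2 t) ∂(runLaw A D T)
      = ∫ y : ((Fin T → D.Ω) × A.Seed) × D.Ω, g (Function.update y.1.1 t y.2 t)
          (bidAt A D (Function.update y.1.1 t y.2) y.1.2 t) ∂((runLaw A D T).prod D.law) := by
        rw [← resample.map_eq] at reward_integrable
        conv_lhs => rw [← resample.map_eq]
        exact integral_map resample.aemeasurable reward_integrable.aestronglyMeasurable
    _ = ∫ y : ((Fin T → D.Ω) × A.Seed) × D.Ω, g y.2 (bidAt A D y.1.1 y.1.2 t)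
          ∂((runLaw A D T).prod D.law) := by
        simp only [Function.update_self, bidAt_update A D ((hD _).trans (hD _).symm)]
    _ = ∫ z, ∫ x, g x (bidAt A D z.1 z.2 t) ∂D.law ∂(runLaw A D T) :=
        integral_prod _ (integrable_resampled_reward A hg hC t)

theorem integral_sum_reward_eq (hD : D ∈ repeatedLaws v)
    (hg : Measurable fun z : D.Ω × ℝ≥0 => g z.1 z.2) (hC : ∀ x b, |g x b| ≤ C) :
    ∫ z, ∑ t, g (z.1 t) (bidAt A D z.1 z.2 t) ∂(runLaw A D T)
      = ∫ z, ∑ t, ∫ x, g x (bidAt A D z.1 z.2 t) ∂D.law ∂(runLaw A D T) := by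
  rw [integral_finsetSum _ fun t _ => integrable_reward A hg hC t,
    integral_finsetSum _ fun t _ => (integrable_resampled_reward A hg hC t).integral_prod_left]
  exact Finset.sum_congr rfl fun t _ => integral_reward_eq A hD hg hC t

theorem expValue_eq_integral_meanGain (hD : D ∈ repeatedLaws v) :
    expValue A D T = ∫ z, ∑ t, D.meanGain (bidAt A D z.1 z.2 t) ∂(runLaw A D T) :=
  integral_sum_reward_eq A hD (measurable_gain D) (abs_gain_le_one D)

theorem integral_pathPayment_eq_integral_meanPayment (hD : D ∈ repeatedLaws v) :
    ∫ z, pathPayment A D T z ∂(runLaw A D T)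
      = ∫ z, ∑ t, D.meanPayment (bidAt A D z.1 z.2 t) ∂(runLaw A D T) :=
  integral_sum_reward_eq A hD (measurable_payment D) (abs_payment_le_one D)

theorem meanPayment_sub_meanGain (b : ℝ≥0) :
    D.meanPayment b - D.meanGain b
      = ∫ x, (D.payment x b - D.value x * D.alloc x b) ∂D.law :=
  (integral_sub
    (integrable_of_abs_le ((measurable_payment D).comp measurable_prodMk_right)
      fun x => abs_payment_le_one D x b)
    (integrable_of_abs_le ((measurable_gain D).comp measurable_prodMk_right)
      fun x => abs_gain_le_one D x b)).symm

end MeanRewards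

section LowBids

variable (A : OnlineAlg) (D : InputLaw) (T : ℕ) (c : ℝ≥0)

/-- The expected number of slots in which `A` bids less than `c`. -/
def expBidsBelow : ℝ :=
  ∫ z, ∑ t, (if bidAt A D z.1 z.2 t < c then 1 else 0) ∂(runLaw A D T)

theorem expBidsBelow_nonneg : 0 ≤ expBidsBelow A D T c :=
  integral_nonneg fun _ => Finset.sum_nonneg fun _ _ => by split_ifs <;> simp

theorem integrable_bidBelow (t : Fin T) :
    Integrable (fun z : (Fin T → D.Ω) × A.Seed =>
      if bidAt A D z.1 z.2 t < c then (1 : ℝ) else 0) (runLaw A D T) :=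
  integrable_of_abs_le (C := 1) (.ite (measurableSet_lt (measurable_bidAt A D t) measurable_const)
    measurable_const measurable_const) fun _ => by split_ifs <;> simp

variable {A D T c} {v α γ : ℝ}

theorem le_integral_sum_reward (hD : D ∈ repeatedLaws v) {g : D.Ω → ℝ≥0 → ℝ} {C : ℝ}
    (hg : Measurable fun z : D.Ω × ℝ≥0 => g z.1 z.2) (hC : ∀ x b, |g x b| ≤ C)
    (h : ∀ b, α - γ * (if b < c then 1 else 0) ≤ ∫ x, g x b ∂D.law) :
    α * T - γ * expBidsBelow A D T c
      ≤ ∫ z, ∑ t, g (z.1 t) (bidAt A D z.1 z.2 t) ∂(runLaw A D T) := by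
  have below_integrable := integrable_bidBelow A D T c
  calc α * T - γ * expBidsBelow A D T c
      = ∫ z, ∑ t : Fin T, (α - γ * (if bidAt A D z.1 z.2 t < c then 1 else 0))
          ∂(runLaw A D T) := by
        simp only [Finset.sum_sub_distrib, ← Finset.mul_sum]
        rw [integral_sub (integrable_const _)
          ((integrable_finsetSum _ fun t _ => below_integrable t).const_mul γ),
          integral_const_mul, expBidsBelow]
        simp [mul_comm]
    _ ≤ ∫ z, ∑ t, ∫ x, g x (bidAt A D z.1 z.2 t) ∂D.law ∂(runLaw A D T) :=
        integral_mono
          (integrable_finsetSum _ fun t _ => (integrable_const α).sub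
            ((below_integrable t).const_mul γ))
          (integrable_finsetSum _ fun t _ =>
            (integrable_resampled_reward A hg hC t).integral_prod_left)
          fun z => Finset.sum_le_sum fun t _ => h _
    _ = ∫ z, ∑ t, g (z.1 t) (bidAt A D z.1 z.2 t) ∂(runLaw A D T) :=
        (integral_sum_reward_eq A hD hg hC).symm

theorem expValue_le_of_meanGain_le (hD : D ∈ repeatedLaws v)
    (h : ∀ b, D.meanGain b ≤ α - γ * (if b < c then 1 else 0)) :
    expValue A D T ≤ α * T - γ * expBidsBelow A D T c := by
  have loss_ge := le_integral_sum_reward (A := A) (T := T) (c := c) (α := -α) (γ := -γ) hD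
    (measurable_gain D).neg (fun x b => (abs_neg _).trans_le (abs_gain_le_one D x b)) fun b => by
      rw [integral_neg]
      change _ ≤ -D.meanGain b
      linarith [h b]
  simp only [Finset.sum_neg_distrib, integral_neg] at loss_ge
  change _ ≤ -expValue A D T at loss_ge
  linarith

theorem le_expCCV_of_le_meanPayment_sub_meanGain (hD : D ∈ repeatedLaws v)
    (h : ∀ b, α - γ * (if b < c then 1 else 0) ≤ D.meanPayment b - D.meanGain b) :
    α * T - γ * expBidsBelow A D T c ≤ expCCV A D T :=
  le_integral_sum_reward hD ((measurable_payment D).sub (measurable_gain D))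
    (abs_payment_sub_gain_le_one D) fun b => (h b).trans_eq (meanPayment_sub_meanGain b)

end LowBids

section ChangeOfMeasure

variable (A : OnlineAlg) (D : InputLaw) (T : ℕ) (c : ℝ≥0)

theorem expBidsBelow_withLaw (μ : Measure D.Ω) [IsProbabilityMeasure μ] :
    expBidsBelow A (D.withLaw μ) T c
      = ∫ ω, ∫ s, ∑ t, (if bidAt A D ω s t < c then 1 else 0) ∂A.seedLaw
          ∂(Measure.pi fun _ : Fin T => μ) := by
  simp only [← bidAt_withLaw A D μ]
  exact integral_prod _ (integrable_finsetSum _ fun t _ =>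
    integrable_bidBelow A (D.withLaw μ) T c t)

theorem pow_mul_sq_expBidsBelow_withLaw_le [Finite D.Ω] [MeasurableSingletonClass D.Ω]
    {μ₀ μ₁ μ₂ : Measure D.Ω} [IsProbabilityMeasure μ₀] [IsProbabilityMeasure μ₁]
    [IsProbabilityMeasure μ₂] {r : ℝ} (hr : 0 ≤ r)
    (h : ∀ x, r * μ₁.real {x} ^ 2 ≤ μ₀.real {x} * μ₂.real {x}) :
    r ^ T * expBidsBelow A (D.withLaw μ₁) T c ^ 2
      ≤ expBidsBelow A (D.withLaw μ₀) T c * expBidsBelow A (D.withLaw μ₂) T c := by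
  simp only [expBidsBelow_withLaw]
  exact mul_sq_integral_le_of_singleton (pow_nonneg hr T) (pow_mul_sq_pi_real_singleton_le hr h)
    fun ω => integral_nonneg fun s => Finset.sum_nonneg fun t _ => by split_ifs <;> simp

end ChangeOfMeasure

section StaticBids

/-- The algorithm that draws one bid from `π` and repeats it in every slot. -/
def staticBid (π : Measure ℝ≥0) [IsProbabilityMeasure π] : OnlineAlg where
  Seed := ℝ≥0
  seedLaw := π
  bid _ s _ _ := s
  measurable_bid _ := measurable_fst

variable {v : ℝ} {D : InputLaw} (π : Measure ℝ≥0) [IsProbabilityMeasure π] (T : ℕ)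

variable (D) in
theorem integral_sum_bidAt_staticBid (h : ℝ≥0 → ℝ) :
    ∫ z, ∑ t : Fin T, h (bidAt (staticBid π) D z.1 z.2 t) ∂(runLaw (staticBid π) D T)
      = T * ∫ b, h b ∂π := by
  calc ∫ z, ∑ t : Fin T, h (bidAt (staticBid π) D z.1 z.2 t) ∂(runLaw (staticBid π) D T)
      = ∫ z, T * h z.2 ∂((Measure.pi fun _ : Fin T => D.law).prod π) := by
        simp only [bidAt, staticBid, runLaw, Finset.sum_const, Finset.card_univ,
          Fintype.card_fin, nsmul_eq_mul]
        rfl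
    _ = T * ∫ b, h b ∂π := by
        rw [integral_const_mul, integral_fun_snd, probReal_univ, one_smul]

theorem expValue_staticBid (hD : D ∈ repeatedLaws v) :
    expValue (staticBid π) D T = T * ∫ b, D.meanGain b ∂π :=
  (expValue_eq_integral_meanGain _ hD).trans (integral_sum_bidAt_staticBid D π T _)

theorem integral_pathPayment_staticBid (hD : D ∈ repeatedLaws v) :
    ∫ z, pathPayment (staticBid π) D T z ∂(runLaw (staticBid π) D T)
      = T * ∫ b, D.meanPayment b ∂π :=
  (integral_pathPayment_eq_integral_meanPayment _ hD).trans
    (integral_sum_bidAt_staticBid D π T _)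

variable {π}

theorem mul_integral_meanGain_le_optValue (hD : D ∈ repeatedLaws v)
    (hπ : ∫ b, D.meanPayment b ∂π ≤ ∫ b, D.meanGain b ∂π) :
    T * ∫ b, D.meanGain b ∂π ≤ optValue D T := by
  rw [← expValue_staticBid π T hD]
  refine expValue_le_optValue ?_
  change _ ≤ expValue (staticBid π) D T
  rw [expValue_staticBid π T hD, integral_pathPayment_staticBid π T hD]
  exact mul_le_mul_of_nonneg_left hπ (Nat.cast_nonneg T)

end StaticBids

section ThresholdInputs

/-- The threshold input with constant value `v` and the random threshold `θ` on the probability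
space `(Ω, μ)`. -/
abbrev thresholdInput (v : unitInterval) {Ω : Type} [MeasurableSpace Ω]
    {θ : Ω → Set.Ioc (0 : ℝ≥0) 1} (hθ : Measurable θ) (μ : Measure Ω) [IsProbabilityMeasure μ] :
    InputLaw where
  Ω := Ω
  law := μ
  value _ := v
  alloc x b := if (θ x : ℝ≥0) ≤ b then 1 else 0
  price x b := if (θ x : ℝ≥0) ≤ b then ((θ x : ℝ≥0) : ℝ) else 0
  measurable_value := measurable_const
  measurable_alloc := .ite (measurableSet_le (by fun_prop) measurable_snd)
    measurable_const measurable_const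
  measurable_price := .ite (measurableSet_le (by fun_prop) measurable_snd)
    (by fun_prop) measurable_const
  value_mem _ := v.2
  alloc_mem x b := by split_ifs <;> simp
  alloc_mono x b b' hb := by
    dsimp only
    split_ifs with h h' <;> first | exact absurd (h.trans hb) h' | norm_num
  alloc_zero x := if_neg (θ x).2.1.not_ge
  price_mem x b := by
    split_ifs
    · exact ⟨NNReal.coe_nonneg _, NNReal.coe_le_one.2 (θ x).2.2⟩
    · exact unitInterval.zero_mem
  price_mono x b b' hb := by
    dsimp only
    split_ifs with h h' <;> first | exact absurd (h.trans hb) h' | simp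
  price_eq_zero x b := by split_ifs <;> simp
  price_le_bid x b := by
    split_ifs with h
    · exact NNReal.coe_le_coe.2 h
    · exact NNReal.coe_nonneg b

variable (v : unitInterval) {Ω : Type} [MeasurableSpace Ω] {θ : Ω → Set.Ioc (0 : ℝ≥0) 1}
  (hθ : Measurable θ) (μ : Measure Ω) [IsProbabilityMeasure μ]

theorem payment_thresholdInput (x : Ω) (b : ℝ≥0) :
    (thresholdInput v hθ μ).payment x b
      = if (θ x : ℝ≥0) ≤ b then ((θ x : ℝ≥0) : ℝ) else 0 := by
  simp only [InputLaw.payment]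
  split_ifs <;> simp

theorem thresholdInput_mem_thresholdLaws : thresholdInput v hθ μ ∈ thresholdLaws v :=
  ⟨fun _ => rfl, fun x => ⟨θ x, (θ x).2.2, fun b => ⟨rfl, payment_thresholdInput v hθ μ x b⟩⟩⟩

theorem pow_mul_sq_expBidsBelow_thresholdInput_le [Finite Ω] [MeasurableSingletonClass Ω]
    {μ₀ μ₁ μ₂ : Measure Ω} [IsProbabilityMeasure μ₀] [IsProbabilityMeasure μ₁]
    [IsProbabilityMeasure μ₂] {r : ℝ} (hr : 0 ≤ r)
    (h : ∀ x, r * μ₁.real {x} ^ 2 ≤ μ₀.real {x} * μ₂.real {x}) (A : OnlineAlg) (T : ℕ) (c : ℝ≥0) :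
    r ^ T * expBidsBelow A (thresholdInput v hθ μ₁) T c ^ 2
      ≤ expBidsBelow A (thresholdInput v hθ μ₀) T c
        * expBidsBelow A (thresholdInput v hθ μ₂) T c :=
  pow_mul_sq_expBidsBelow_withLaw_le A (thresholdInput v hθ μ₀) T c hr h

end ThresholdInputs

theorem thresholdLaws_subset_repeatedLaws (v : ℝ) : thresholdLaws v ⊆ repeatedLaws v :=
  fun _ hD => hD.1

section TwoPrices

/-- The threshold input with value `v` whose threshold is `hi` with probability `p` and `lo` with
probability `1 - p`. -/
def twoPriceLaw (v : unitInterval) (lo hi : Set.Ioc (0 : ℝ≥0) 1) (p : unitInterval) : InputLaw :=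
  thresholdInput v (θ := fun x : Bool => cond x hi lo) .of_discrete Ber(true, false, p)

variable (v : unitInterval) (lo hi : Set.Ioc (0 : ℝ≥0) 1) (p : unitInterval)

theorem twoPriceLaw_mem_thresholdLaws : twoPriceLaw v lo hi p ∈ thresholdLaws v :=
  thresholdInput_mem_thresholdLaws v .of_discrete _

theorem twoPriceLaw_mem_repeatedLaws : twoPriceLaw v lo hi p ∈ repeatedLaws v :=
  thresholdLaws_subset_repeatedLaws v (twoPriceLaw_mem_thresholdLaws v lo hi p)

theorem meanGain_twoPriceLaw (b : ℝ≥0) :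
    (twoPriceLaw v lo hi p).meanGain b
      = p * (v * if (hi : ℝ≥0) ≤ b then 1 else 0)
        + (1 - p) * (v * if (lo : ℝ≥0) ≤ b then 1 else 0) :=
  integral_bernoulliMeasure true false p _

theorem meanPayment_twoPriceLaw (b : ℝ≥0) :
    (twoPriceLaw v lo hi p).meanPayment b
      = p * (if (hi : ℝ≥0) ≤ b then ((hi : ℝ≥0) : ℝ) else 0)
        + (1 - p) * (if (lo : ℝ≥0) ≤ b then ((lo : ℝ≥0) : ℝ) else 0) := by
  refine (integral_bernoulliMeasure true false p _).trans ?_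
  simp only [twoPriceLaw, payment_thresholdInput, cond_true, cond_false, smul_eq_mul]

variable {v lo hi p} (A : OnlineAlg) (T : ℕ)

theorem expValue_twoPriceLaw_le :
    expValue A (twoPriceLaw v lo hi p) T
      ≤ v * T - v * p * expBidsBelow A (twoPriceLaw v lo hi p) T hi := by
  refine expValue_le_of_meanGain_le (twoPriceLaw_mem_repeatedLaws v lo hi p) fun b => ?_
  rw [meanGain_twoPriceLaw]
  have low_price_gain_nonneg : 0 ≤ (v : ℝ) * (1 - p) :=
    mul_nonneg v.2.1 (sub_nonneg.2 p.2.2)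
  rcases lt_or_ge b (hi : ℝ≥0) with hb | hb
  · rw [if_pos hb, if_neg hb.not_ge]
    split_ifs <;> linarith
  · rw [if_neg hb.not_gt, if_pos hb]
    split_ifs <;> linarith

theorem le_expCCV_twoPriceLaw (hlo : ((lo : ℝ≥0) : ℝ) ≤ v) :
    (p * ((hi : ℝ≥0) - v) + (1 - p) * ((lo : ℝ≥0) - v) : ℝ) * T
        - p * ((hi : ℝ≥0) - v : ℝ) * expBidsBelow A (twoPriceLaw v lo hi p) T hi
      ≤ expCCV A (twoPriceLaw v lo hi p) T := by
  refine le_expCCV_of_le_meanPayment_sub_meanGain (twoPriceLaw_mem_repeatedLaws v lo hi p)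
    fun b => ?_
  rw [meanPayment_twoPriceLaw, meanGain_twoPriceLaw]
  have low_price_margin_nonneg : 0 ≤ (1 - (p : ℝ)) * (v - (lo : ℝ≥0)) :=
    mul_nonneg (sub_nonneg.2 p.2.2) (sub_nonneg.2 hlo)
  rcases lt_or_ge b (hi : ℝ≥0) with hb | hb
  · rw [if_pos hb, if_neg hb.not_ge, if_neg hb.not_ge]
    split_ifs <;> linarith
  · rw [if_neg hb.not_gt, if_pos hb, if_pos hb]
    split_ifs <;> linarith

theorem le_optValue_twoPriceLaw (h : lo < hi) {q : unitInterval}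
    (hq : (1 - p) * ((lo : ℝ≥0) : ℝ) + (1 - q) * p * (hi : ℝ≥0) ≤ v * (1 - p * q)) :
    v * (1 - p * q : ℝ) * T ≤ optValue (twoPriceLaw v lo hi p) T := by
  have h' : (lo : ℝ≥0) < hi := h
  have gain_eq : ∫ b, (twoPriceLaw v lo hi p).meanGain b ∂Ber((lo : ℝ≥0), (hi : ℝ≥0), q)
      = v * (1 - p * q) := by
    rw [integral_bernoulliMeasure]
    simp only [meanGain_twoPriceLaw, le_refl, h'.le, h'.not_ge, if_true, if_false, smul_eq_mul]
    ring
  have payment_eq : ∫ b, (twoPriceLaw v lo hi p).meanPayment b ∂Ber((lo : ℝ≥0), (hi : ℝ≥0), q)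
      = (1 - p) * (lo : ℝ≥0) + (1 - q) * p * (hi : ℝ≥0) := by
    rw [integral_bernoulliMeasure]
    simp only [meanPayment_twoPriceLaw, le_refl, h'.le, h'.not_ge, if_true, if_false, smul_eq_mul]
    ring
  rw [mul_comm, ← gain_eq]
  exact mul_integral_meanGain_le_optValue T (twoPriceLaw_mem_repeatedLaws v lo hi p)
    (by rwa [gain_eq, payment_eq])

theorem le_regret_of_twoPriceLaw_mem {𝒟 : Set InputLaw} (hD : twoPriceLaw v lo hi p ∈ 𝒟)
    (h : lo < hi) {q : unitInterval}
    (hq : (1 - p) * ((lo : ℝ≥0) : ℝ) + (1 - q) * p * (hi : ℝ≥0) ≤ v * (1 - p * q)) :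
    v * p * (expBidsBelow A (twoPriceLaw v lo hi p) T hi - q * T) ≤ regret 𝒟 A T := by
  linarith [optValue_sub_expValue_le_regret hD A T, le_optValue_twoPriceLaw T h hq,
    expValue_twoPriceLaw_le (v := v) (lo := lo) (hi := hi) (p := p) A T]

theorem pow_mul_sq_expBidsBelow_twoPriceLaw_le {p₀ p₁ p₂ : unitInterval} {r : ℝ} (hr : 0 ≤ r)
    (h_hi : r * (p₁ : ℝ) ^ 2 ≤ p₀ * p₂)
    (h_lo : r * (1 - p₁ : ℝ) ^ 2 ≤ (1 - p₀) * (1 - p₂)) (c : ℝ≥0) :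
    r ^ T * expBidsBelow A (twoPriceLaw v lo hi p₁) T c ^ 2
      ≤ expBidsBelow A (twoPriceLaw v lo hi p₀) T c
        * expBidsBelow A (twoPriceLaw v lo hi p₂) T c := by
  refine pow_mul_sq_expBidsBelow_thresholdInput_le v .of_discrete hr (fun x => ?_) A T c
  cases x
  · simpa using h_lo
  · simpa using h_hi

theorem sq_expBidsBelow_twoPriceLaw_le {p₀ p₁ p₂ : unitInterval} {ε : ℝ}
    (hp₀ : (p₀ : ℝ) = 1 / 2) (hp₁ : (p₁ : ℝ) = 1 / 2 + ε) (hp₂ : (p₂ : ℝ) = 1 / 2 + 2 * ε)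
    (hε : 32 * ε ^ 2 * T ≤ 1) (c : ℝ≥0) :
    expBidsBelow A (twoPriceLaw v lo hi p₁) T c ^ 2
      ≤ 2 * (expBidsBelow A (twoPriceLaw v lo hi p₀) T c
        * expBidsBelow A (twoPriceLaw v lo hi p₂) T c) := by
  have ε_le : ε ≤ 1 / 4 := by linarith [p₂.2.2]
  have le_ε : -(1 / 4) ≤ ε := by linarith [p₂.2.1]
  have sq_ε_le : 16 * ε ^ 2 ≤ 1 := by nlinarith
  have half_le_pow : 1 / 2 ≤ (1 - 16 * ε ^ 2) ^ T := by
    have bernoulli := one_add_mul_le_pow (a := -(16 * ε ^ 2)) (by linarith) T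
    rw [← sub_eq_add_neg] at bernoulli
    linarith
  -- `1 / 2 * (1 / 2 ± 2 * ε) = (1 / 2 ± ε) ^ 2 - ε ^ 2`, where `1 / 16 ≤ (1 / 2 ± ε) ^ 2`.
  have high_price_masses : (1 - 16 * ε ^ 2) * (p₁ : ℝ) ^ 2 ≤ p₀ * p₂ := by
    have sq_ge : (1 / 4) ^ 2 ≤ (1 / 2 + ε) ^ 2 := pow_le_pow_left₀ (by norm_num) (by linarith) 2
    rw [hp₀, hp₁, hp₂]
    linarith [mul_le_mul_of_nonneg_left sq_ge (sq_nonneg ε)]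
  have low_price_masses : (1 - 16 * ε ^ 2) * (1 - p₁ : ℝ) ^ 2 ≤ (1 - p₀) * (1 - p₂) := by
    have sq_ge : (1 / 4) ^ 2 ≤ (1 / 2 - ε) ^ 2 := pow_le_pow_left₀ (by norm_num) (by linarith) 2
    rw [hp₀, hp₁, hp₂]
    linarith [mul_le_mul_of_nonneg_left sq_ge (sq_nonneg ε)]
  have change_of_measure := pow_mul_sq_expBidsBelow_twoPriceLaw_le (v := v) (lo := lo) (hi := hi)
    A T (sub_nonneg.2 sq_ε_le) high_price_masses low_price_masses c
  linarith [mul_le_mul_of_nonneg_right half_le_pow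
    (sq_nonneg (expBidsBelow A (twoPriceLaw v lo hi p₁) T c))]

section Symmetric

variable {d : ℝ} {𝒟 : Set InputLaw}

theorem le_regret_of_symmetric_prices (hlo : ((lo : ℝ≥0) : ℝ) = v - d)
    (hhi : ((hi : ℝ≥0) : ℝ) = v + d) (hd : 0 < d) (hD : twoPriceLaw v lo hi p ∈ 𝒟)
    {q : unitInterval} (hq : (2 * p - 1 : ℝ) ≤ p * q) :
    v * p * (expBidsBelow A (twoPriceLaw v lo hi p) T hi - q * T) ≤ regret 𝒟 A T := by
  refine le_regret_of_twoPriceLaw_mem A T hD (NNReal.coe_lt_coe.1 (by linarith)) ?_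
  rw [hlo, hhi]
  linarith [mul_le_mul_of_nonneg_left hq hd.le]

theorem le_worstCCV_of_symmetric_prices (hlo : ((lo : ℝ≥0) : ℝ) = v - d)
    (hhi : ((hi : ℝ≥0) : ℝ) = v + d) (hd : 0 ≤ d) (hD : twoPriceLaw v lo hi p ∈ 𝒟) :
    d * ((2 * p - 1) * T - p * expBidsBelow A (twoPriceLaw v lo hi p) T hi)
      ≤ worstCCV 𝒟 A T := by
  have violation := le_expCCV_twoPriceLaw (v := v) (lo := lo) (hi := hi) (p := p) A T (by linarith)
  rw [hlo, hhi] at violation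
  linarith [expCCV_le_worstCCV hD A T]

end Symmetric

end TwoPrices

/-- Here `R` and `C` stand for regret and violation, and `N₀`, `N₁`, `N₂` for the numbers of low
bids under three biases. -/
theorem mul_le_add_of_tradeoff {v d p s R C N₀ N₁ N₂ : ℝ} (hd : 0 < d) (hdv : 2 * d ≤ v)
    (hs : 0 < s) (hN₀ : 0 ≤ N₀) (regret₀ : v / 2 * N₀ ≤ R) (violation₀ : -(d / 2) * N₀ ≤ C)
    (violation₁ : d * (s / 8 - N₁) ≤ C) (hp : 1 / 2 ≤ p)
    (regret₂ : v * p * (N₂ - s) ≤ R)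
    (h : N₁ ^ 2 ≤ 2 * (N₀ * N₂)) : d / 512 * s ≤ R + C := by
  by_contra! small
  have hv : 0 < v := by linarith
  have d_mul_N₀_le : d * N₀ ≤ R := by nlinarith
  have R_le : R ≤ d * (s / 256) := by linarith
  have N₀_le : N₀ ≤ s / 256 := le_of_mul_le_mul_left (d_mul_N₀_le.trans R_le) hd
  have N₂_le : N₂ - s ≤ s / 256 := by
    by_contra! large
    have half_v_mul_le : v / 2 * (N₂ - s) ≤ v * p * (N₂ - s) := by
      gcongr
      · linarith
      · linarith [mul_le_mul_of_nonneg_left hp hv.le]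
    nlinarith
  have N₁_ge : s / 8 - N₁ ≤ s / 512 := by
    refine le_of_mul_le_mul_left ?_ hd
    nlinarith
  have product_le : N₀ * N₂ ≤ s / 256 * (s + s / 256) :=
    mul_le_mul_of_nonneg N₀_le (by linarith) hN₀ (by linarith)
  have sq_le : (63 / 512 * s) ^ 2 ≤ N₁ ^ 2 := pow_le_pow_left₀ (by positivity) (by linarith) 2
  linarith [pow_pos hs 2]

theorem mul_sqrt_le_regret_add_worstCCV {v : unitInterval} {lo hi : Set.Ioc (0 : ℝ≥0) 1} {d : ℝ}
    (hd : 0 < d) (hdv : 2 * d ≤ v) (hlo : ((lo : ℝ≥0) : ℝ) = v - d)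
    (hhi : ((hi : ℝ≥0) : ℝ) = v + d) {𝒟 : Set InputLaw} (h𝒟 : ∀ p, twoPriceLaw v lo hi p ∈ 𝒟)
    {T : ℕ} (hT : 1 ≤ T) (A : OnlineAlg) :
    d / 512 * √T ≤ regret 𝒟 A T + worstCCV 𝒟 A T := by
  have sqrt_sq : √(T : ℝ) ^ 2 = T := Real.sq_sqrt (Nat.cast_nonneg T)
  have one_le_sqrt : 1 ≤ √(T : ℝ) := Real.one_le_sqrt.2 (by exact_mod_cast hT)
  generalize √(T : ℝ) = s at sqrt_sq one_le_sqrt ⊢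
  have s_pos : 0 < s := one_pos.trans_le one_le_sqrt
  obtain ⟨ε, hε⟩ : ∃ ε, ε * s = 1 / 16 := ⟨1 / 16 / s, div_mul_cancel₀ _ s_pos.ne'⟩
  have ε_nonneg : 0 ≤ ε := nonneg_of_mul_nonneg_left (by rw [hε]; norm_num) s_pos
  have ε_le : ε ≤ 1 / 16 := hε ▸ le_mul_of_one_le_right ε_nonneg one_le_sqrt
  have ε_mul_T : ε * T = s / 16 := by rw [← sqrt_sq, sq, ← mul_assoc, hε]; ring
  let p₀ : unitInterval := ⟨1 / 2, by norm_num, by norm_num⟩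
  let p₁ : unitInterval := ⟨1 / 2 + ε, by linarith, by linarith⟩
  let p₂ : unitInterval := ⟨1 / 2 + 2 * ε, by linarith, by linarith⟩
  let q : unitInterval := ⟨16 * ε, by linarith, by linarith⟩
  have regret₀ := le_regret_of_symmetric_prices A T hlo hhi hd (h𝒟 p₀) (q := 0) (by simp [p₀])
  have violation₀ := le_worstCCV_of_symmetric_prices A T hlo hhi hd.le (h𝒟 p₀)
  have violation₁ := le_worstCCV_of_symmetric_prices A T hlo hhi hd.le (h𝒟 p₁)
  have regret₂ := le_regret_of_symmetric_prices A T hlo hhi hd (h𝒟 p₂) (q := q)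
    (by simp only [p₂, q]; nlinarith)
  have counts := sq_expBidsBelow_twoPriceLaw_le (v := v) (lo := lo) (hi := hi) A T (p₀ := p₀)
    (p₁ := p₁) (p₂ := p₂) rfl rfl rfl (by nlinarith) hi
  have N₀_nonneg := expBidsBelow_nonneg A (twoPriceLaw v lo hi p₀) T hi
  have N₁_nonneg := expBidsBelow_nonneg A (twoPriceLaw v lo hi p₁) T hi
  have drift : (2 * p₁ - 1 : ℝ) * T = s / 8 := by simp only [p₁]; linarith
  have budget : (q : ℝ) * T = s := by simp only [q]; linarith
  rw [drift] at violation₁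
  rw [budget] at regret₂
  refine mul_le_add_of_tradeoff hd hdv s_pos N₀_nonneg (by simpa [p₀, div_eq_mul_inv] using regret₀)
    ?_ (violation₁.trans' ?_) (le_add_of_nonneg_right (by positivity)) regret₂ counts
  · simp only [p₀] at violation₀
    linarith
  · gcongr
    exact mul_le_of_le_one_left N₁_nonneg p₁.2.2

end AutoBid

end

theorem mainTheorem2 (v : ℝ) (hv0 : 0 < v) (hv1 : v < 1) :
    ∃ c : ℝ, 0 < c ∧ ∀ T : ℕ, 1 ≤ T → ∀ A : AutoBid.OnlineAlg,
      c * Real.sqrt T ≤ AutoBid.regret (AutoBid.repeatedLaws v) A T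
          + AutoBid.worstCCV (AutoBid.repeatedLaws v) A T ∧
      c * Real.sqrt T ≤ AutoBid.regret (AutoBid.thresholdLaws v) A T
          + AutoBid.worstCCV (AutoBid.thresholdLaws v) A T := by
  obtain ⟨d, hd⟩ : ∃ d, d = min v (1 - v) / 2 := ⟨_, rfl⟩
  have d_pos : 0 < d := by rw [hd]; exact half_pos (lt_min hv0 (sub_pos.2 hv1))
  have two_d_le : 2 * d ≤ v := by linarith [min_le_left v (1 - v)]
  have v_add_d_le : v + d ≤ 1 := by linarith [min_le_right v (1 - v)]
  let lo : Set.Ioc (0 : ℝ≥0) 1 := ⟨⟨v - d, by linarith⟩,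
    NNReal.coe_pos.1 (show 0 < v - d by linarith), NNReal.coe_le_one.1 (show v - d ≤ 1 by linarith)⟩
  let hi : Set.Ioc (0 : ℝ≥0) 1 := ⟨⟨v + d, by linarith⟩,
    NNReal.coe_pos.1 (show 0 < v + d by linarith), NNReal.coe_le_one.1 v_add_d_le⟩
  refine ⟨d / 512, by positivity, fun T hT A => ⟨?_, ?_⟩⟩
  · exact AutoBid.mul_sqrt_le_regret_add_worstCCV (v := ⟨v, hv0.le, hv1.le⟩) (lo := lo) (hi := hi)
      d_pos two_d_le rfl rfl (AutoBid.twoPriceLaw_mem_repeatedLaws _ _ _) hT A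
  · exact AutoBid.mul_sqrt_le_regret_add_worstCCV (v := ⟨v, hv0.le, hv1.le⟩) (lo := lo) (hi := hi)
      d_pos two_d_le rfl rfl (AutoBid.twoPriceLaw_mem_thresholdLaws _ _ _) hT A
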